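/- Let $\Omega$ be a finite set of questions, $b\ge 1$ an integer, and $g:2^{\Omega}\to\mathbb R$ a non-decreasing submodular function with $g(\emptyset)=0$. Each $q\in\Omega$ has an answer probability $p_q^+\in[0,1]$ and a continuation probability $c_q^+\in[0,1]$. A customer is shown a sequence $Q$ of distinct questions (no "Prefer Not to Answer" (PNA) option is offered). She reads the first one; after reading a question $q$ she answers it and goes on to read the next question with probability $p_q^+c_q^+$, answers it and exits with probability $p_q^+(1-c_q^+)$, and exits without answering with probability $1-p_q^+$. Let $\Pr[\mathcal S\mid Q]$ be the probability that the set of answered questions is exactly $\mathcal S$, and let $f(Q)=\sum_{\mathcal S\subseteq Q}\Pr[\mathcal S\mid Q]\,g(\mathcal S)$. Let $Q^*$ be a sequence of at most $b$ distinct questions that maximizes $f$. For $\rho\in[0,1]$, $q\in\Omega$ and $\mathcal S\subseteq\Omega$ put $u(q,\mathcal S)=p_q^+\,g(\mathcal S\cup\{q\})+(1-p_q^+)\,g(\mathcal S)$, and call $(q,\mathcal S)$ admissible if $-\sum_{l\in\mathcal S}\log(p_l^+c_l^+)\le-\log\rho$ (with $\log 0=-\infty$), $|\mathcal S|<b$ and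 $q\notin\mathcal S$. Let $\epsilon\ge 0$. For a fixed $q$, a set $\mathcal S$ is called a $(1-1/e-\epsilon)$-approximate solution for $q$ if $(q,\mathcal S)$ is admissible and $u(q,\mathcal S)\ge(1-1/e-\epsilon)\,u(q,\mathcal T)$ for every $\mathcal T$ such that $(q,\mathcal T)$ is admissible. Algorithm 1, on input $\rho$, $b$, $\Omega$, works as follows. Start with $q'$ void and $\mathcal S'=\emptyset$ (a pair of value $g(\emptyset)=0$). Scan the questions $q\in\Omega$ one by one in some order; for each $q$ obtain some $(1-1/e-\epsilon)$-approximate solution $\mathcal S$ for $q$ from a subroutine, and if $u(q,\mathcal S)>u(q',\mathcal S')$, replace $(q',\mathcal S')$ by $(q,\mathcal S)$. Return the sequence $Q^{\mathrm{Alg1}}$ that lists the elements of $\mathcal S'$ in an arbitrary order, followed by $q'$ (if it is not void). **Theorem.** For every $\rho\in[0,1]$ the algorithm has an output, and every possible output $Q^{\mathrm{Alg1}}$ (for every scanning order, every choice of approximate solutions and every ordering of $\mathcal S'$) is a sequence of at most $b$ distinct questions with $$f(Q^{\mathrm{Alg1}})\ \ge\ \rho(1-\rho)\,(1-1/e-\epsilon)\,f(Q^*).$$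 **Corollary.** With $\rho=1/2$, $f(Q^{\mathrm{Alg1}})\ge\frac{1-1/e-\epsilon}{4}\,f(Q^*)$. -/

import Mathlib

/-- The parameters of the cascade browse model on a pool `α` of questions. After reading `q`, the
customer answers it with probability `pPlus q`, selects "Prefer Not to Answer" (PNA) with
probability `pMinus q`, and otherwise exits; after answering (resp. selecting PNA) she continues to
the next question with probability `cPlus q` (resp. `cMinus q`). -/
structure CascadeModel (α : Type*) where
  pPlus : α → ℝ
  pMinus : α → ℝ
  cPlus : α → ℝ
  cMinus : α → ℝ
  pPlus_nonneg : ∀ q, 0 ≤ pPlus q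
  pMinus_nonneg : ∀ q, 0 ≤ pMinus q
  p_le_one : ∀ q, pPlus q + pMinus q ≤ 1
  cPlus_nonneg : ∀ q, 0 ≤ cPlus q
  cPlus_le_one : ∀ q, cPlus q ≤ 1
  cMinus_nonneg : ∀ q, 0 ≤ cMinus q
  cMinus_le_one : ∀ q, cMinus q ≤ 1

/-- The five actions available to the customer after reading a question. -/
inductive QuizAction where
  | answerContinue
  | answerExit
  | pnaContinue
  | pnaExit
  | exit
  deriving DecidableEq

instance : Fintype QuizAction where
  elems := {.answerContinue, .answerExit, .pnaContinue, .pnaExit, .exit}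
  complete := by intro a; cases a <;> decide

/-- Diminishing returns. -/
def IsSubmodular {α : Type*} [DecidableEq α] (g : Finset α → ℝ) : Prop :=
  ∀ Y₁ Y₂ : Finset α, Y₁ ⊆ Y₂ → ∀ y, y ∉ Y₂ →
    g (insert y Y₂) - g Y₂ ≤ g (insert y Y₁) - g Y₁

namespace CascadeModel

variable {α : Type*} (M : CascadeModel α)

/-- The PNA option is not offered. -/
def NoPNA : Prop := ∀ q, M.pMinus q = 0

/-- Probabilities of the five actions after reading `q`. -/
def actionProb (q : α) : QuizAction → ℝ
  | .answerContinue => M.pPlus q * M.cPlus q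
  | .answerExit => M.pPlus q * (1 - M.cPlus q)
  | .pnaContinue => M.pMinus q * M.cMinus q
  | .pnaExit => M.pMinus q * (1 - M.cMinus q)
  | .exit => 1 - (M.pPlus q + M.pMinus q)

theorem actionProb_nonneg (q : α) (a : QuizAction) : 0 ≤ M.actionProb q a := by
  have h1 := M.pPlus_nonneg q
  have h2 := M.pMinus_nonneg q
  have h3 := M.p_le_one q
  have h4 := M.cPlus_nonneg q
  have h5 := M.cPlus_le_one q
  have h6 := M.cMinus_nonneg q
  have h7 := M.cMinus_le_one q
  cases a
  · exact mul_nonneg h1 h4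
  · exact mul_nonneg h1 (sub_nonneg.2 h5)
  · exact mul_nonneg h2 h6
  · exact mul_nonneg h2 (sub_nonneg.2 h7)
  · exact sub_nonneg.2 h3

theorem sum_actionProb (q : α) : ∑ a, ENNReal.ofReal (M.actionProb q a) = 1 := by
  rw [← ENNReal.ofReal_sum_of_nonneg (fun a _ => M.actionProb_nonneg q a)]
  have h : ∑ a, M.actionProb q a = 1 := by
    have hu : (Finset.univ : Finset QuizAction) =
        {.answerContinue, .answerExit, .pnaContinue, .pnaExit, .exit} := by decide
    rw [hu]
    simp [actionProb]
    ring
  rw [h, ENNReal.ofReal_one]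

/-- The law of the action taken after reading `q`. -/
noncomputable def action (q : α) : PMF QuizAction :=
  PMF.ofFintype (fun a => ENNReal.ofReal (M.actionProb q a)) (M.sum_actionProb q)

variable [DecidableEq α]

/-- The law of the (random) set of questions that the customer answers when the sequence is
displayed to her: she reads the first question, acts, and goes on to the rest of the sequence if
she continues. -/
noncomputable def answered : List α → PMF (Finset α)
  | [] => PMF.pure ∅
  | q :: Q => (M.action q).bind fun a =>
      match a with
      | .answerContinue => (answered Q).map (insert q)
      | .answerExit => PMF.pure {q}
      | .pnaContinue => answered Q
      | .pnaExit => PMF.pure ∅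
      | .exit => PMF.pure ∅

/-- The expected utility `f(Q) = ∑_{S ⊆ Q} Pr[S | Q] g(S)`. -/
noncomputable def expectedUtility (g : Finset α → ℝ) (Q : List α) : ℝ :=
  ∑ S ∈ Q.toFinset.powerset, (M.answered Q S).toReal * g S

/-- The objective `u(q, S) = p_q⁺ g(S ∪ {q}) + (1 - p_q⁺) g(S)`. -/
def objective (g : Finset α → ℝ) (q : α) (S : Finset α) : ℝ :=
  M.pPlus q * g (insert q S) + (1 - M.pPlus q) * g S

/-- The constraints on `(q, S)`: `-∑_{l ∈ S} log (p_l⁺ c_l⁺) ≤ -log ρ`, `|S| < b` and `q ∉ S`.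
The logarithms are taken in the extended reals, with `log 0 = -∞`. -/
def IsFeasiblePair (ρ : ℝ) (b : ℕ) (q : α) (S : Finset α) : Prop :=
  -∑ l ∈ S, ENNReal.log (ENNReal.ofReal (M.pPlus l * M.cPlus l)) ≤
      -ENNReal.log (ENNReal.ofReal ρ) ∧
    S.card < b ∧ q ∉ S

/-- For fixed `q`, the set `S` is an `r`-approximate solution of: maximize `u(q, S)` subject to the
constraints above. -/
def IsApproxSolution (g : Finset α → ℝ) (ρ : ℝ) (b : ℕ) (r : ℝ) (q : α) (S : Finset α) : Prop :=
  M.IsFeasiblePair ρ b q S ∧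
    ∀ T, M.IsFeasiblePair ρ b q T → r * M.objective g q T ≤ M.objective g q S

/-- The value `u(q', S')` of the current best pair of the algorithm. The initial `q'` is void
(`none`), in which case only `S'` contributes. -/
def currentValue (g : Finset α → ℝ) : Option α × Finset α → ℝ
  | (none, S) => g S
  | (some q, S) => M.objective g q S

/-- One pass of the loop: replace the current best pair by `(q, S)`, where `S = solve q`, if this is
a strict improvement. -/
noncomputable def loopStep (g : Finset α → ℝ) (solve : α → Finset α)
    (best : Option α × Finset α) (q : α) : Option α × Finset α :=
  if M.currentValue g best < M.objective g q (solve q) then (some q, solve q) else best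

/-- `Q` is a possible output of the algorithm on input `ρ, b`, when every call of the subroutine
returns some `r`-approximate solution. The questions are scanned in some order, the best candidate
pair `(q', S')` is retained, and `Q` is `S'`, in an arbitrary order, followed by `q'`. -/
def IsAlgorithmOutput (g : Finset α → ℝ) (ρ : ℝ) (b : ℕ) (r : ℝ) (Q : List α) : Prop :=
  ∃ (order : List α) (solve : α → Finset α) (q' : Option α) (S' : Finset α) (L : List α),
    (order.Nodup ∧ ∀ q, q ∈ order) ∧
    (∀ q, M.IsApproxSolution g ρ b r q (solve q)) ∧
    order.foldl (M.loopStep g solve) (none, ∅) = (q', S') ∧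
    (L.Nodup ∧ L.toFinset = S') ∧
    Q = L ++ q'.toList

/-- Feasible sequences: no question is repeated and at most `b` questions are selected. -/
def IsFeasibleSequence (b : ℕ) (Q : List α) : Prop := Q.Nodup ∧ Q.length ≤ b

/-- `Q` maximizes the expected utility over all feasible sequences. -/
def IsOptimalSequence (g : Finset α → ℝ) (b : ℕ) (Q : List α) : Prop :=
  IsFeasibleSequence b Q ∧
    ∀ Q', IsFeasibleSequence b Q' → M.expectedUtility g Q' ≤ M.expectedUtility g Q

end CascadeModel

/-! Without PNA, question `q` in a sequence `A ++ q :: B` is reached exactly when all of `A` is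
answered and passed, which has probability `reachProb A`; the logarithmic constraint says that this
is at least `ρ`. Cut an optimal sequence at its last question `q` reached with probability at least
`ρ`. The tail `B` then contributes at most `ρ` times its own value (`value_append_le`, by
submodularity), and that value is at most the optimum because `B` is itself feasible. So the head `A
++ [q]` keeps a fraction `1 - ρ`, and `u(q, A)` bounds its value from above (`value_le_objective`).
Conversely, displaying an admissible `S` and then `q` earns at least `ρ * u(q, S)`
(`reachProb_mul_objective_le_value`). The subroutine costs the remaining factor `r`. -/

namespace PMF

/-! ### Expectations under finite laws -/

/-- The expectation of a real function under a law on a finite type. -/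
noncomputable def expect {β : Type*} [Fintype β] (P : PMF β) (g : β → ℝ) : ℝ :=
  ∑ S, (P S).toReal * g S

theorem expect_pure {β : Type*} [Fintype β] (a : β) (g : β → ℝ) :
    (PMF.pure a).expect g = g a := by
  classical
  simp only [expect, PMF.pure_apply]
  rw [Finset.sum_eq_single a]
  · simp
  · intro b _ hb
    simp [hb]
  · simp

theorem expect_bind {β γ : Type*} [Fintype β] [Fintype γ] (P : PMF γ) (F : γ → PMF β)
    (g : β → ℝ) : (P.bind F).expect g = ∑ a, (P a).toReal * (F a).expect g := by
  have h (S : β) : (P.bind F S).toReal = ∑ a, (P a).toReal * (F a S).toReal := by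
    rw [PMF.bind_apply, tsum_fintype, ENNReal.toReal_sum]
    · simp [ENNReal.toReal_mul]
    · intro a _
      exact ENNReal.mul_ne_top (P.apply_ne_top a) ((F a).apply_ne_top S)
  simp only [expect, h, Finset.sum_mul, Finset.mul_sum]
  rw [Finset.sum_comm]
  simp only [mul_assoc]

theorem expect_map {β γ : Type*} [Fintype β] [Fintype γ] (P : PMF γ) (h : γ → β)
    (g : β → ℝ) : (P.map h).expect g = P.expect (fun S => g (h S)) := by
  rw [← PMF.bind_pure_comp, expect_bind]
  simp only [Function.comp_apply, expect_pure]
  rfl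

end PMF

/-- Inductions along a sequence replace `g` by its version conditioned on `x` having been answered.
-/
theorem IsSubmodular.comp_insert {α : Type*} [DecidableEq α] {g : Finset α → ℝ}
    (hg : IsSubmodular g) (x : α) : IsSubmodular (fun S => g (insert x S)) := by
  intro Y₁ Y₂ hY y hy
  by_cases hyx : y = x
  · subst hyx
    simp
  · have := hg (insert x Y₁) (insert x Y₂) (Finset.insert_subset_insert x hY) y
      (by simp [hyx, hy])
    simpa only [Finset.insert_comm x y] using this

theorem Monotone.comp_finset_insert {α : Type*} [DecidableEq α] {g : Finset α → ℝ}
    (hg : Monotone g) (x : α) : Monotone (fun S => g (insert x S)) :=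
  fun _ _ h => hg (Finset.insert_subset_insert x h)

/-! ### Reach probabilities and the admissibility constraint -/

namespace CascadeModel

variable {α : Type*} (M : CascadeModel α)

/-- The probability that `q` is answered and the customer continues. -/
def passProb (q : α) : ℝ := M.pPlus q * M.cPlus q

theorem passProb_nonneg (q : α) : 0 ≤ M.passProb q :=
  mul_nonneg (M.pPlus_nonneg q) (M.cPlus_nonneg q)

theorem pPlus_le_one (q : α) : M.pPlus q ≤ 1 := by
  linarith [M.p_le_one q, M.pMinus_nonneg q]

theorem passProb_le_pPlus (q : α) : M.passProb q ≤ M.pPlus q :=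
  mul_le_of_le_one_right (M.pPlus_nonneg q) (M.cPlus_le_one q)

/-- The probability that the customer answers all of `Q` and continues. -/
def reachProb (Q : List α) : ℝ := (Q.map M.passProb).prod

@[simp] theorem reachProb_nil : M.reachProb [] = 1 := rfl

@[simp] theorem reachProb_cons (q : α) (Q : List α) :
    M.reachProb (q :: Q) = M.passProb q * M.reachProb Q := by
  simp [reachProb]

theorem reachProb_nonneg (Q : List α) : 0 ≤ M.reachProb Q := by
  induction Q with
  | nil => simp
  | cons q Q ih => simpa using mul_nonneg (M.passProb_nonneg q) ih

/-- Stop at the first question whose passing would bring the product below `ρ`, or at the last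
question. The factor `a` carries the product over the prefix already removed. -/
theorem exists_split_reachProb {ρ : ℝ} (Q : List α) (hQ : Q ≠ []) :
    ∀ a : ℝ, ρ ≤ a → ∃ A q B, Q = A ++ q :: B ∧ ρ ≤ a * M.reachProb A ∧
      (B = [] ∨ a * M.reachProb (A ++ [q]) < ρ) := by
  induction Q with
  | nil => exact absurd rfl hQ
  | cons x Q ih =>
    intro a ha
    by_cases hnil : Q = []
    · exact ⟨[], x, [], by simp [hnil], by simpa using ha, Or.inl rfl⟩
    by_cases hx : a * M.passProb x < ρ
    · exact ⟨[], x, Q, rfl, by simpa using ha, Or.inr (by simpa using hx)⟩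
    obtain ⟨A, q, B, hAB, hA, hB⟩ := ih hnil (a * M.passProb x) (not_lt.1 hx)
    refine ⟨x :: A, q, B, by simp [hAB], by simpa [mul_assoc] using hA, ?_⟩
    simpa [mul_assoc] using hB

variable [DecidableEq α]

theorem reachProb_eq_prod (Q : List α) (hQ : Q.Nodup) :
    M.reachProb Q = ∏ q ∈ Q.toFinset, M.passProb q :=
  (List.prod_toFinset M.passProb hQ).symm

/-- Vanishing pass probabilities need no separate case, since `log 0 = -∞` keeps the logarithm
additive. -/
theorem sum_log_passProb (S : Finset α) :
    ∑ l ∈ S, ENNReal.log (ENNReal.ofReal (M.pPlus l * M.cPlus l)) =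
      ENNReal.log (ENNReal.ofReal (∏ l ∈ S, M.passProb l)) := by
  induction S using Finset.induction_on with
  | empty => simp
  | insert x S hx ih =>
    rw [Finset.sum_insert hx, Finset.prod_insert hx, ih,
      ENNReal.ofReal_mul (M.passProb_nonneg x), ENNReal.log_mul_add, passProb]

theorem isFeasiblePair_iff (ρ : ℝ) (b : ℕ) (q : α) (S : Finset α) :
    M.IsFeasiblePair ρ b q S ↔
      ρ ≤ ∏ l ∈ S, M.passProb l ∧ S.card < b ∧ q ∉ S := by
  rw [IsFeasiblePair, sum_log_passProb, EReal.neg_le_neg_iff, ENNReal.log_le_log_iff,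
    ENNReal.ofReal_le_ofReal_iff (Finset.prod_nonneg fun l _ => M.passProb_nonneg l)]

theorem isFeasiblePair_empty {ρ : ℝ} (hρ : ρ ≤ 1) {b : ℕ} (hb : 0 < b) (q : α) :
    M.IsFeasiblePair ρ b q ∅ := by
  rw [isFeasiblePair_iff]
  simpa using ⟨hρ, hb⟩

theorem le_objective {g : Finset α → ℝ} (hg : Monotone g) (q : α) (S : Finset α) :
    g S ≤ M.objective g q S := by
  have := mul_le_mul_of_nonneg_left (hg (Finset.subset_insert q S)) (M.pPlus_nonneg q)
  rw [objective]
  linarith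

/-- An exact maximizer serves, because `r ≤ 1` and objectives are nonnegative; `∅` is a candidate.
-/
theorem exists_isApproxSolution [Fintype α] {g : Finset α → ℝ} (hg : Monotone g)
    (hg0 : ∀ S, 0 ≤ g S) {ρ r : ℝ} (hρ : ρ ≤ 1) (hr : r ≤ 1) {b : ℕ} (hb : 0 < b) (q : α) :
    ∃ S, M.IsApproxSolution g ρ b r q S := by
  classical
  obtain ⟨S, hS, hmax⟩ := Finset.exists_max_image
    (Finset.univ.filter fun S => M.IsFeasiblePair ρ b q S) (M.objective g q)
    ⟨∅, by simpa using M.isFeasiblePair_empty hρ hb q⟩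
  refine ⟨S, by simpa using hS, fun T hT => ?_⟩
  calc r * M.objective g q T ≤ M.objective g q T :=
        mul_le_of_le_one_left ((hg0 T).trans (M.le_objective hg q T)) hr
    _ ≤ M.objective g q S := hmax T (by simpa using hT)

/-! ### Recursive form of the expected utility -/

/-- The expected utility without the PNA option, by recursion on the sequence. -/
def value (g : Finset α → ℝ) : List α → ℝ
  | [] => g ∅
  | q :: Q => M.passProb q * value (fun S => g (insert q S)) Q +
      (M.pPlus q - M.passProb q) * g {q} + (1 - M.pPlus q) * g ∅

theorem subset_of_answered_ne_zero (Q : List α) (S : Finset α) (hS : M.answered Q S ≠ 0) :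
    S ⊆ Q.toFinset := by
  induction Q generalizing S with
  | nil =>
    have : S = ∅ := by simpa [answered] using hS
    simp [this]
  | cons q Q ih =>
    rw [answered, ← PMF.mem_support_iff, PMF.mem_support_bind_iff] at hS
    obtain ⟨a, -, ha⟩ := hS
    rw [List.toFinset_cons]
    cases a with
    | answerContinue =>
      obtain ⟨T, hT, rfl⟩ := (PMF.mem_support_map_iff _ _ _).1 ha
      exact Finset.insert_subset_insert q (ih T hT)
    | answerExit =>
      have : S = {q} := by simpa using ha
      simp [this]
    | pnaContinue => exact (ih S ha).trans (Finset.subset_insert _ _)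
    | pnaExit =>
      have : S = ∅ := by simpa using ha
      simp [this]
    | exit =>
      have : S = ∅ := by simpa using ha
      simp [this]

theorem expect_answered [Fintype α] (hM : M.NoPNA) (g : Finset α → ℝ) (Q : List α) :
    (M.answered Q).expect g = M.value g Q := by
  induction Q generalizing g with
  | nil => exact PMF.expect_pure _ _
  | cons q Q ih =>
    have hu : (Finset.univ : Finset QuizAction) =
        {.answerContinue, .answerExit, .pnaContinue, .pnaExit, .exit} := by decide
    have ha (a : QuizAction) : (M.action q a).toReal = M.actionProb q a :=
      ENNReal.toReal_ofReal (M.actionProb_nonneg q a)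
    rw [answered, PMF.expect_bind, hu]
    simp [ha, PMF.expect_pure, PMF.expect_map, ih, actionProb, hM q, value, passProb]
    ring

theorem expectedUtility_eq_value [Fintype α] (hM : M.NoPNA) (g : Finset α → ℝ) (Q : List α) :
    M.expectedUtility g Q = M.value g Q := by
  rw [← M.expect_answered hM, expectedUtility, PMF.expect]
  refine Finset.sum_subset (Finset.subset_univ _) fun S _ hS => ?_
  have : M.answered Q S = 0 := by
    by_contra h
    exact hS (Finset.mem_powerset.2 (M.subset_of_answered_ne_zero Q S h))
  simp [this]

theorem value_mono {g h : Finset α → ℝ} (hgh : ∀ S, g S ≤ h S) (Q : List α) :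
    M.value g Q ≤ M.value h Q := by
  induction Q generalizing g h with
  | nil => exact hgh ∅
  | cons q Q ih =>
    have h1 := mul_le_mul_of_nonneg_left (ih fun S => hgh (insert q S)) (M.passProb_nonneg q)
    have h2 := mul_le_mul_of_nonneg_left (hgh {q}) (sub_nonneg.2 (M.passProb_le_pPlus q))
    have h3 := mul_le_mul_of_nonneg_left (hgh ∅) (sub_nonneg.2 (M.pPlus_le_one q))
    exact add_le_add (add_le_add h1 h2) h3

theorem value_add_const (g : Finset α → ℝ) (c : ℝ) (Q : List α) :
    M.value (fun S => g S + c) Q = M.value g Q + c := by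
  induction Q generalizing g with
  | nil => rfl
  | cons q Q ih =>
    simp only [value]
    rw [ih fun S => g (insert q S)]
    ring

theorem value_nonneg {g : Finset α → ℝ} (hg : ∀ S, 0 ≤ g S) (Q : List α) : 0 ≤ M.value g Q := by
  induction Q generalizing g with
  | nil => exact hg ∅
  | cons q Q ih =>
    exact add_nonneg (add_nonneg
      (mul_nonneg (M.passProb_nonneg q) (ih fun S => hg (insert q S)))
      (mul_nonneg (sub_nonneg.2 (M.passProb_le_pPlus q)) (hg {q})))
      (mul_nonneg (sub_nonneg.2 (M.pPlus_le_one q)) (hg ∅))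

theorem value_singleton (g : Finset α → ℝ) (q : α) : M.value g [q] = M.objective g q ∅ := by
  simp only [value, objective, insert_empty_eq]
  ring

theorem objective_comp_insert (g : Finset α → ℝ) (q x : α) (S : Finset α) :
    M.objective (fun T => g (insert x T)) q S = M.objective g q (insert x S) := by
  simp only [objective, Finset.insert_comm x q]

/-! ### Comparing the value of a sequence with the objective -/

/-- Discard the nonnegative contribution of customers who leave before reaching `q`; the others hold
all of `L`. -/
theorem reachProb_mul_objective_le_value {g : Finset α → ℝ} (hg : ∀ S, 0 ≤ g S) (L : List α)
    (q : α) : M.reachProb L * M.objective g q L.toFinset ≤ M.value g (L ++ [q]) := by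
  induction L generalizing g with
  | nil => simp [value_singleton]
  | cons x L ih =>
    have h1 := mul_le_mul_of_nonneg_left (ih fun S => hg (insert x S)) (M.passProb_nonneg x)
    have h2 := mul_nonneg (sub_nonneg.2 (M.passProb_le_pPlus x)) (hg {x})
    have h3 := mul_nonneg (sub_nonneg.2 (M.pPlus_le_one x)) (hg ∅)
    rw [objective_comp_insert] at h1
    rw [List.cons_append, value, reachProb_cons, List.toFinset_cons]
    linarith

/-- A customer who leaves early holds a subset of `L`, worth at most `g L` and so at most the
objective. -/
theorem value_le_objective {g : Finset α → ℝ} (hg : Monotone g) (L : List α) (q : α) :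
    M.value g (L ++ [q]) ≤ M.objective g q L.toFinset := by
  induction L generalizing g with
  | nil => simp [value_singleton]
  | cons x L ih =>
    have h1 := mul_le_mul_of_nonneg_left (ih (hg.comp_finset_insert x)) (M.passProb_nonneg x)
    have hle (S : Finset α) (hS : S ⊆ insert x L.toFinset) :
        g S ≤ M.objective g q (insert x L.toFinset) := (hg hS).trans (M.le_objective hg q _)
    have h2 := mul_le_mul_of_nonneg_left (hle {x} (by simp))
      (sub_nonneg.2 (M.passProb_le_pPlus x))
    have h3 := mul_le_mul_of_nonneg_left (hle ∅ (by simp)) (sub_nonneg.2 (M.pPlus_le_one x))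
    rw [objective_comp_insert] at h1
    rw [List.cons_append, value, List.toFinset_cons]
    linarith

/-- `B` matters only once `A` is passed, and by diminishing returns it then adds no more than it
would starting from `∅`. -/
theorem value_append_le {g : Finset α → ℝ} (hg : Monotone g) (hsub : IsSubmodular g)
    (A B : List α) :
    M.value g (A ++ B) ≤ M.value g A + M.reachProb A * (M.value g B - g ∅) := by
  induction A generalizing g with
  | nil => simp [value]
  | cons x A ih =>
    have h1 := ih (hg.comp_finset_insert x) (hsub.comp_insert x)
    have h2 : M.value (fun S => g (insert x S)) B ≤ M.value g B + (g {x} - g ∅) := by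
      rw [← value_add_const]
      refine M.value_mono (fun S => ?_) B
      -- Submodularity covers only `x ∉ S`; otherwise the left side is `g S` and monotonicity
      -- suffices.
      by_cases hx : x ∈ S
      · rw [Finset.insert_eq_of_mem hx]
        linarith [hg (Finset.empty_subset {x})]
      · have := hsub ∅ S (Finset.empty_subset S) x hx
        rw [insert_empty_eq] at this
        linarith
    have h3 : M.value (fun S => g (insert x S)) (A ++ B) ≤
        M.value (fun S => g (insert x S)) A + M.reachProb A * (M.value g B - g ∅) := by
      refine h1.trans (add_le_add_right (mul_le_mul_of_nonneg_left ?_ (M.reachProb_nonneg A)) _)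
      rw [insert_empty_eq]
      linarith
    have h4 := mul_le_mul_of_nonneg_left h3 (M.passProb_nonneg x)
    rw [List.cons_append, value, value, reachProb_cons]
    linarith

/-- Cutting a sequence of maximal value at the last question reached with probability at least `ρ`
yields a feasible pair whose objective loses at most a fraction `ρ` of that value. -/
theorem exists_isFeasiblePair_objective_ge {g : Finset α → ℝ} (hg : Monotone g)
    (hg_empty : g ∅ = 0) (hsub : IsSubmodular g) {ρ : ℝ} (hρ0 : 0 ≤ ρ) (hρ : ρ ≤ 1) {b : ℕ}
    (Q : List α) (hQ : Q ≠ []) (hfeas : IsFeasibleSequence b Q)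
    (hmax : ∀ Q', IsFeasibleSequence b Q' → M.value g Q' ≤ M.value g Q) :
    ∃ q S, M.IsFeasiblePair ρ b q S ∧ (1 - ρ) * M.value g Q ≤ M.objective g q S := by
  obtain ⟨A, q, B, rfl, hA, hB⟩ := M.exists_split_reachProb Q hQ 1 hρ
  rw [one_mul] at hA
  obtain ⟨hnd, hlen⟩ := hfeas
  rw [List.nodup_append] at hnd
  obtain ⟨hAnd, hqB, hdisj⟩ := hnd
  have hg0 (S : Finset α) : 0 ≤ g S := hg_empty ▸ hg (Finset.empty_subset S)
  refine ⟨q, A.toFinset, ?_, ?_⟩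
  · rw [isFeasiblePair_iff, ← M.reachProb_eq_prod A hAnd, List.toFinset_card_of_nodup hAnd]
    refine ⟨hA, ?_, fun hq => hdisj q (List.mem_toFinset.1 hq) q (by simp) rfl⟩
    simp only [List.length_append, List.length_cons] at hlen
    omega
  · refine le_trans ?_ (M.value_le_objective hg A q)
    rcases hB with rfl | hB
    · exact mul_le_of_le_one_left (M.value_nonneg hg0 _) (by linarith)
    · have h1 := M.value_append_le hg hsub (A ++ [q]) B
      -- The tail competes with the whole sequence, which is where optimality enters.
      have h2 : M.value g B ≤ M.value g (A ++ q :: B) := by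
        refine hmax B ⟨(List.nodup_cons.1 hqB).2, ?_⟩
        simp only [List.length_append, List.length_cons] at hlen
        omega
      rw [one_mul] at hB
      rw [hg_empty, sub_zero, List.append_assoc, List.singleton_append] at h1
      have h3 := mul_le_mul hB.le h2 (M.value_nonneg hg0 B) hρ0
      linarith

/-! ### The scanning loop and its output -/

theorem currentValue_le_loopStep (g : Finset α → ℝ) (solve : α → Finset α)
    (best : Option α × Finset α) (q : α) :
    M.currentValue g best ≤ M.currentValue g (M.loopStep g solve best q) ∧
      M.objective g q (solve q) ≤ M.currentValue g (M.loopStep g solve best q) := by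
  unfold loopStep
  split_ifs with h
  · exact ⟨h.le, le_rfl⟩
  · exact ⟨le_rfl, not_lt.1 h⟩

theorem currentValue_le_foldl (g : Finset α → ℝ) (solve : α → Finset α) (order : List α)
    (best : Option α × Finset α) :
    M.currentValue g best ≤ M.currentValue g (order.foldl (M.loopStep g solve) best) ∧
      ∀ q ∈ order, M.objective g q (solve q) ≤
        M.currentValue g (order.foldl (M.loopStep g solve) best) := by
  induction order generalizing best with
  | nil => simp
  | cons x order ih =>
    obtain ⟨h1, h2⟩ := ih (M.loopStep g solve best x)
    obtain ⟨h3, h4⟩ := M.currentValue_le_loopStep g solve best x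
    refine ⟨h3.trans h1, fun q hq => ?_⟩
    rcases List.mem_cons.1 hq with rfl | hq
    · exact h4.trans h1
    · exact h2 q hq

/-- Ensures that a retained pair comes from `solve`, and so inherits admissibility. -/
theorem foldl_loopStep_eq (g : Finset α → ℝ) (solve : α → Finset α) (order : List α)
    (best : Option α × Finset α) :
    order.foldl (M.loopStep g solve) best = best ∨
      ∃ q, order.foldl (M.loopStep g solve) best = (some q, solve q) := by
  induction order generalizing best with
  | nil => exact Or.inl rfl
  | cons x order ih =>
    rw [List.foldl_cons]
    rcases ih (M.loopStep g solve best x) with h | h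
    · rw [h, loopStep]
      split_ifs
      · exact Or.inr ⟨x, rfl⟩
      · exact Or.inl rfl
    · exact Or.inr h

theorem exists_isAlgorithmOutput [Fintype α] {g : Finset α → ℝ} (hg : Monotone g)
    (hg0 : ∀ S, 0 ≤ g S) {ρ r : ℝ} (hρ : ρ ≤ 1) (hr : r ≤ 1) {b : ℕ} (hb : 0 < b) :
    ∃ Q, M.IsAlgorithmOutput g ρ b r Q := by
  choose solve hsolve using fun q => M.exists_isApproxSolution hg hg0 hρ hr hb q
  exact ⟨_, Finset.univ.toList, solve, _, _, _, ⟨Finset.nodup_toList _, by simp⟩, hsolve, rfl,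
    ⟨Finset.nodup_toList _, Finset.toList_toFinset _⟩, rfl⟩

theorem IsAlgorithmOutput.feasible_and_value_ge {M : CascadeModel α} {g : Finset α → ℝ}
    (hg : Monotone g) (hg_empty : g ∅ = 0) {ρ r : ℝ} (hρ0 : 0 ≤ ρ) {b : ℕ}
    {Q : List α} (hQ : M.IsAlgorithmOutput g ρ b r Q) :
    IsFeasibleSequence b Q ∧ ∀ q S, M.IsFeasiblePair ρ b q S →
      ρ * (r * M.objective g q S) ≤ M.value g Q := by
  have hg0 (S : Finset α) : 0 ≤ g S := hg_empty ▸ hg (Finset.empty_subset S)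
  obtain ⟨order, solve, q', S', L, ⟨-, horder⟩, hsolve, hfold, ⟨hL, hLS⟩, rfl⟩ := hQ
  have hbest (q : α) (S : Finset α) (h : M.IsFeasiblePair ρ b q S) :
      ρ * (r * M.objective g q S) ≤ ρ * M.currentValue g (q', S') := by
    refine mul_le_mul_of_nonneg_left (((hsolve q).2 S h).trans ?_) hρ0
    rw [← hfold]
    exact (M.currentValue_le_foldl g solve order _).2 q (horder q)
  rcases M.foldl_loopStep_eq g solve order (none, ∅) with h | ⟨q, h⟩
  -- Void output: the retained value is `g ∅ = 0`, which is also the value of the empty sequence.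
  · rw [hfold] at h
    obtain ⟨rfl, rfl⟩ := Prod.mk.inj h
    obtain rfl : L = [] := by simpa using hLS
    refine ⟨⟨by simp, by simp⟩, fun q S hS => (hbest q S hS).trans ?_⟩
    simp [currentValue, value, hg_empty]
  · rw [hfold] at h
    obtain ⟨rfl, rfl⟩ := Prod.mk.inj h
    obtain ⟨hprod, hcard, hmem⟩ := (M.isFeasiblePair_iff ρ b q _).1 (hsolve q).1
    rw [← hLS, List.toFinset_card_of_nodup hL] at hcard
    rw [← hLS, ← M.reachProb_eq_prod L hL] at hprod
    rw [← hLS, List.mem_toFinset] at hmem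
    refine ⟨⟨?_, by simpa using hcard⟩, fun q₁ S hS => (hbest q₁ S hS).trans ?_⟩
    · rw [Option.toList_some, List.nodup_append]
      exact ⟨hL, by simp, fun a ha c hc => by rintro rfl; simp_all⟩
    · refine le_trans ?_ (M.reachProb_mul_objective_le_value hg0 L q)
      rw [hLS]
      exact mul_le_mul_of_nonneg_right hprod ((hg0 _).trans (M.le_objective hg q _))

/-! ### The approximation guarantee -/

theorem IsAlgorithmOutput.expectedUtility_ge [Fintype α] {M : CascadeModel α} (hM : M.NoPNA)
    {g : Finset α → ℝ} (hg : Monotone g) (hg_empty : g ∅ = 0) (hsub : IsSubmodular g)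
    {ρ r : ℝ} (hρ0 : 0 ≤ ρ) (hρ : ρ ≤ 1) {b : ℕ} {Q : List α}
    (hQ : M.IsAlgorithmOutput g ρ b r Q) {Qopt : List α} (hopt : M.IsOptimalSequence g b Qopt) :
    ρ * (1 - ρ) * r * M.expectedUtility g Qopt ≤ M.expectedUtility g Q := by
  obtain ⟨hfeas, hmax⟩ := hopt
  simp only [M.expectedUtility_eq_value hM] at hmax ⊢
  have hg0 (S : Finset α) : 0 ≤ g S := hg_empty ▸ hg (Finset.empty_subset S)
  have hv := M.value_nonneg hg0 Qopt
  -- A large `ε` makes `r` negative; the bound is then trivial, and `r > 0` allows multiplying by it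
  -- below.
  rcases le_or_gt r 0 with hr | hr
  · exact (mul_nonpos_of_nonpos_of_nonneg (mul_nonpos_of_nonneg_of_nonpos
      (mul_nonneg hρ0 (sub_nonneg.2 hρ)) hr) hv).trans (M.value_nonneg hg0 Q)
  by_cases hnil : Qopt = []
  · subst hnil
    simpa [value, hg_empty] using M.value_nonneg hg0 Q
  obtain ⟨q, S, hS, hle⟩ :=
    M.exists_isFeasiblePair_objective_ge hg hg_empty hsub hρ0 hρ Qopt hnil hfeas hmax
  calc ρ * (1 - ρ) * r * M.value g Qopt = ρ * (r * ((1 - ρ) * M.value g Qopt)) := by ring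
    _ ≤ ρ * (r * M.objective g q S) :=
      mul_le_mul_of_nonneg_left (mul_le_mul_of_nonneg_left hle hr.le) hρ0
    _ ≤ M.value g Q := (hQ.feasible_and_value_ge hg hg_empty hρ0).2 q S hS

end CascadeModel

theorem mainTheorem2 {α : Type*} [Fintype α] [DecidableEq α] (M : CascadeModel α)
    (hM : M.NoPNA) (g : Finset α → ℝ) (hg_empty : g ∅ = 0) (hg_mono : Monotone g)
    (hg_sub : IsSubmodular g) (b : ℕ) (hb : 0 < b) (ε : ℝ) (hε : 0 ≤ ε) :
    (∀ ρ : ℝ, 0 ≤ ρ → ρ ≤ 1 →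
      (∃ Q, M.IsAlgorithmOutput g ρ b (1 - 1 / Real.exp 1 - ε) Q) ∧
      ∀ Q, M.IsAlgorithmOutput g ρ b (1 - 1 / Real.exp 1 - ε) Q →
        CascadeModel.IsFeasibleSequence b Q ∧
        ∀ Qopt, M.IsOptimalSequence g b Qopt →
          ρ * (1 - ρ) * (1 - 1 / Real.exp 1 - ε) * M.expectedUtility g Qopt ≤
            M.expectedUtility g Q) ∧
    (∀ Q, M.IsAlgorithmOutput g (1 / 2) b (1 - 1 / Real.exp 1 - ε) Q →
      ∀ Qopt, M.IsOptimalSequence g b Qopt →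
        (1 - 1 / Real.exp 1 - ε) / 4 * M.expectedUtility g Qopt ≤ M.expectedUtility g Q) := by
  have hg0 (S : Finset α) : 0 ≤ g S := hg_empty ▸ hg_mono (Finset.empty_subset S)
  have hr : 1 - 1 / Real.exp 1 - ε ≤ 1 := by
    have : 0 < 1 / Real.exp 1 := by positivity
    linarith
  refine ⟨fun ρ hρ0 hρ => ⟨M.exists_isAlgorithmOutput hg_mono hg0 hρ hr hb, fun Q hQ =>
    ⟨(hQ.feasible_and_value_ge hg_mono hg_empty hρ0).1, fun Qopt hopt =>
      hQ.expectedUtility_ge hM hg_mono hg_empty hg_sub hρ0 hρ hopt⟩⟩, fun Q hQ Qopt hopt => ?_⟩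
  -- At `ρ = 1/2` the factor `ρ * (1 - ρ)` takes its maximum `1/4`.
  refine le_of_eq_of_le ?_
    (hQ.expectedUtility_ge hM hg_mono hg_empty hg_sub (by norm_num) (by norm_num) hopt)
  ring
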